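/- **Conventions.** All sets of points are finite. For relations $s\subseteq X\times X$ put $s^*=\{(y,x)\mid (x,y)\in s\}$ and $xs=\{y\mid (x,y)\in s\}$. A scheme $(X,S)$ consists of a finite set $X$ and a partition $S$ of $X\times X$ such that $1_X=\{(x,x)\mid x\in X\}\in S$, $s^*\in S$ for all $s\in S$, and for $s,t,u\in S$ the number $p_{st}^u=|\{z\mid (x,z)\in s,(z,y)\in t\}|$ is the same for all $(x,y)\in u$. The valency of $s\in S$ is $|xs|$ (independent of $x\in X$), and $S_i$ is the set of elements of $S$ of valency $i$; the complex product is $st=\{u\in S\mid p_{st}^u\neq0\}$. Let $\sigma_s$ be the adjacency matrix of $s$, let $J_X$ be the all-one matrix, for $U\subseteq X$ let $\varepsilon_U$ be the diagonal $0/1$-matrix with support $U$, and put $J_{U,V}=\varepsilon_UJ_X\varepsilon_V$. The Terwilliger algebra of $(X,S)$ at $x_0\in X$ is the (unital) subalgebra of $\mathrm{Mat}_X(\mathbb C)$ generated by all $\sigma_s$ and $\varepsilon_{x_0s}$, $s\in S$. The wreath product of schemes $(X,S)$ and $(Y,T)$ is the scheme on $X\times Y$ with the relations $\tilde s=\{((x,y),(x',y))\mid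 (x,x')\in s,\ y\in Y\}$ for $s\in S$ and $\bar t=\{((x,y),(x',y'))\mid x,x'\in X,\ (y,y')\in t\}$ for $t\in T\setminus\{1_Y\}$; its set of relations is denoted $S\wr T$. **Setting.** Let $(X,S)$ be a scheme and let $(Y,T)$ be a quasi-thin scheme, i.e. a scheme with $T=T_1\cup T_2$. Fix $x_0\in X$ and $y_0\in Y$, and let $\mathcal T(S\wr T)$ be the Terwilliger algebra of $(X\times Y,S\wr T)$ at $(x_0,y_0)$. For $t\in T_2$ there is a unique $t^\bot\in T$ with $tt^*=\{1_Y,t^\bot\}$; put $T^\bot=\{t^\bot\mid t\in T_2\}$ and assume $T^\bot\neq\emptyset$. For each $t\in T_2$ choose a labelling $y_0t=\{y_{t(1)},y_{t(2)}\}$ of the two elements of $y_0t$, and for $t,t'\in T_2$ put $$G_{y_0t,y_0t'}=\frac1{2|X|}\,J_X\otimes\bigl(J_{\{y_{t(1)}\},\{y_{t'(1)}\}}+J_{\{y_{t(2)}\},\{y_{t'(2)}\}}-J_{\{y_{t(1)}\},\{y_{t'(2)}\}}-J_{\{y_{t(2)}\},\{y_{t'(1)}\}}\bigr).$$ **Statement.**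 (a) Suppose that either $|T^\bot|=1$ and $T^\bot\subseteq T_2$, or $|T^\bot|\ge2$. Then the linear span of $\{G_{y_0t,y_0t'}\mid t,t'\in T_2\}$ is contained in $\mathcal T(S\wr T)$ and is a two-sided ideal of $\mathcal T(S\wr T)$, and it is isomorphic to $\mathrm{Mat}_{T_2}(\mathbb C)$ as a $\mathbb C$-algebra. (b) Suppose that $|T^\bot|=1$ and $T^\bot\subseteq T_1$. Put $H=\{1_Y\}\cup T^\bot$, and for $y\in Y$ put $yH=\bigcup_{h\in H}yh$. Let $T_{(H)}$ be the set of all non-empty relations $t\cap(\Delta\times\Gamma)$ with $t\in T$ and $\Delta,\Gamma\in\{yH\mid y\in Y\}$. A fiber is a set $\Delta\subseteq Y$ with $1_\Delta=\{(y,y)\mid y\in\Delta\}\in T_{(H)}$. For fibers $\Delta,\Gamma$ write $\Delta\sim\Gamma$ if $\Delta\times\Gamma\notin T_{(H)}$; this is an equivalence relation. Let $I$ be the set of its classes, for $i\in I$ let $Y_i$ be the union of the fibers in $i$, and let $i_0\in I$ be the class with $y_0\in Y_{i_0}$. For $i\in I\setminus\{i_0\}$ put $U_i=\{t\in T_2\mid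 y_0t\subseteq Y_i\}$. Then, for every $i\in I\setminus\{i_0\}$, the linear span of $\{G_{y_0t,y_0t'}\mid t,t'\in U_i\}$ is contained in $\mathcal T(S\wr T)$ and is a two-sided ideal of $\mathcal T(S\wr T)$, and it is isomorphic to $\mathrm{Mat}_{U_i}(\mathbb C)$ as a $\mathbb C$-algebra. -/

import Mathlib

open scoped Kronecker

/-! ## Coherent configurations and schemes -/

/-- The identity relation `1_Δ = {(x, x) ∣ x ∈ Δ}` on a subset `Δ`. -/
def idRel {X : Type*} (Δ : Set X) : Set (X × X) := {p | p.1 ∈ Δ ∧ p.1 = p.2}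

/-- The transposed relation `s* = {(y, x) ∣ (x, y) ∈ s}`. -/
def starRel {X : Type*} (s : Set (X × X)) : Set (X × X) := {p | (p.2, p.1) ∈ s}

/-- The neighbourhood `xs = {y ∣ (x, y) ∈ s}`. -/
def nbhd {X : Type*} (x : X) (s : Set (X × X)) : Set X := {y | (x, y) ∈ s}

/-- `(X, S)` is a coherent configuration: `S` is a partition of `X × X` such that the identity
relation is a union of members of `S`, `S` is closed under transposition, and the numbers
`p_{st}^u = |{z ∣ (x, z) ∈ s, (z, y) ∈ t}|` do not depend on the choice of `(x, y) ∈ u`. -/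
structure IsCoherentConfiguration {X : Type*} (S : Set (Set (X × X))) : Prop where
  isPartition : Setoid.IsPartition S
  idRel_mem : ∃ A ⊆ S, ⋃₀ A = idRel (Set.univ : Set X)
  starRel_mem : ∀ s ∈ S, starRel s ∈ S
  intersection_number : ∀ s ∈ S, ∀ t ∈ S, ∀ u ∈ S, ∀ x y x' y' : X,
    (x, y) ∈ u → (x', y') ∈ u →
      {z : X | (x, z) ∈ s ∧ (z, y) ∈ t}.ncard = {z : X | (x', z) ∈ s ∧ (z, y') ∈ t}.ncard

/-- A scheme is a homogeneous coherent configuration, i.e. one with `1_X ∈ S`. -/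
structure IsScheme {X : Type*} (S : Set (Set (X × X))) : Prop
    extends IsCoherentConfiguration S where
  one_mem : idRel (Set.univ : Set X) ∈ S

/-- The set `S_i` of basic relations of valency `i`. -/
def relsOfValency {X : Type*} (S : Set (Set (X × X))) (i : ℕ) : Set (Set (X × X)) :=
  {s ∈ S | ∀ x : X, (nbhd x s).ncard = i}

/-- The complex product `st`: the set of the `u ∈ S` with `p_{st}^u ≠ 0`. -/
def complexProd {X : Type*} (S : Set (Set (X × X))) (s t : Set (X × X)) : Set (Set (X × X)) :=
  {u ∈ S | ∃ x y : X, (x, y) ∈ u ∧ ∃ z : X, (x, z) ∈ s ∧ (z, y) ∈ t}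

/-- A quasi-thin scheme: a scheme all of whose basic relations have valency `1` or `2`. -/
def IsQuasiThin {X : Type*} (S : Set (Set (X × X))) : Prop :=
  IsScheme S ∧ S = relsOfValency S 1 ∪ relsOfValency S 2

/-- The set `T^⊥` of orthogonals `t^⊥`, where `t` has valency `2` and `t t* = {1, t^⊥}`. -/
def orthogonals {Y : Type*} (T : Set (Set (Y × Y))) : Set (Set (Y × Y)) :=
  {u ∈ T | ∃ t ∈ relsOfValency T 2, complexProd T t (starRel t) = {idRel Set.univ, u}}

/-! ## The thin residue extension and its classes of fibers -/

/-- The fibers: the sets `Δ` whose identity relation `1_Δ` is a basic relation. -/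
def fibers {X : Type*} (S : Set (Set (X × X))) : Set (Set X) := {Δ | idRel Δ ∈ S}

/-- The set `X/H = {xH ∣ x ∈ X}`, where `xH` is the union of the `xh` with `h ∈ H`. -/
def cosets {X : Type*} (H : Set (Set (X × X))) : Set (Set X) :=
  Set.range fun x : X => ⋃ h ∈ H, nbhd x h

/-- The extension `S_(H)`: all non-empty relations `s ∩ (Δ × Γ)`, `s ∈ S` and `Δ, Γ ∈ X/H`. -/
def residueExtension {X : Type*} (S H : Set (Set (X × X))) : Set (Set (X × X)) :=
  {r | r.Nonempty ∧ ∃ s ∈ S, ∃ Δ ∈ cosets H, ∃ Γ ∈ cosets H, r = s ∩ Δ ×ˢ Γ}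

/-- The set `I` of classes of the relation `Δ ∼ Γ ↔ Δ × Γ ∉ T_(H)` on the fibers of `T_(H)`, where
`H = {1} ∪ T^⊥`. -/
def fiberClasses {Y : Type*} (T : Set (Set (Y × Y))) : Set (Set (Set Y)) :=
  let TH := residueExtension T ({idRel Set.univ} ∪ orthogonals T)
  {i | ∃ Δ ∈ fibers TH, i = {Γ ∈ fibers TH | Δ ×ˢ Γ ∉ TH}}

/-- For a class `i` with `Y_i = ⋃₀ i`, the set `U_i = {t ∈ T_2 ∣ y₀t ⊆ Y_i}`. -/
def relsOfClass {Y : Type*} (T : Set (Set (Y × Y))) (y₀ : Y) (i : Set (Set Y)) :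
    Set (Set (Y × Y)) :=
  {t ∈ relsOfValency T 2 | nbhd y₀ t ⊆ ⋃₀ i}

/-! ## Wreath products -/

/-- `s̃ = {((x, y), (x', y)) ∣ (x, x') ∈ s}`. -/
def tildeRel {X : Type*} (Y : Type*) (s : Set (X × X)) : Set ((X × Y) × (X × Y)) :=
  {p | (p.1.1, p.2.1) ∈ s ∧ p.1.2 = p.2.2}

/-- `t̄ = {((x, y), (x', y')) ∣ (y, y') ∈ t}`. -/
def barRel (X : Type*) {Y : Type*} (t : Set (Y × Y)) : Set ((X × Y) × (X × Y)) :=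
  {p | (p.1.2, p.2.2) ∈ t}

/-- The wreath product `S ≀ T = {s̃ ∣ s ∈ S} ∪ {t̄ ∣ t ∈ T \ {1_Y}}`. -/
def wreathProd {X Y : Type*} (S : Set (Set (X × X))) (T : Set (Set (Y × Y))) :
    Set (Set ((X × Y) × (X × Y))) :=
  tildeRel Y '' S ∪ barRel X '' (T \ {idRel Set.univ})

/-! ## Matrices and Terwilliger algebras -/

open Classical in
/-- The adjacency matrix `σ_s`. -/
noncomputable def adjMat {X : Type*} (s : Set (X × X)) : Matrix X X ℂ :=
  Matrix.of fun x y => if (x, y) ∈ s then 1 else 0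

open Classical in
/-- The diagonal `0/1`-matrix `ε_U`. -/
noncomputable def diagMat {X : Type*} [DecidableEq X] (U : Set X) : Matrix X X ℂ :=
  Matrix.diagonal fun x => if x ∈ U then 1 else 0

/-- The all-one matrix `J_X`. -/
def allOnes (X : Type*) : Matrix X X ℂ := Matrix.of fun _ _ => 1

/-- `J_{U,V} = ε_U J_X ε_V`. -/
noncomputable def blockOnes {X : Type*} [Fintype X] [DecidableEq X] (U V : Set X) :
    Matrix X X ℂ :=
  diagMat U * allOnes X * diagMat V

/-- The Terwilliger algebra `𝒯(X, S, x₀)`, generated by the `σ_s` and the `ε_{x₀s}`, `s ∈ S`. -/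
noncomputable def terwilligerAlgebra {X : Type*} [Fintype X] [DecidableEq X]
    (S : Set (Set (X × X))) (x₀ : X) : Subalgebra ℂ (Matrix X X ℂ) :=
  Algebra.adjoin ℂ (adjMat '' S ∪ (fun s => diagMat (nbhd x₀ s)) '' S)

/-- The matrix `G_{y₀t, y₀t'}`, where `y₀t = {a t, b t}` for each `t` of valency `2`. -/
noncomputable def gMat (X : Type*) {Y : Type*} [Fintype X] [Fintype Y] [DecidableEq Y]
    (a b : Set (Y × Y) → Y) (t t' : Set (Y × Y)) : Matrix (X × Y) (X × Y) ℂ :=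
  (1 / (2 * (Fintype.card X : ℂ))) •
    (allOnes X ⊗ₖ (blockOnes {a t} {a t'} + blockOnes {b t} {b t'}
      - blockOnes {a t} {b t'} - blockOnes {b t} {a t'}))

/-- The linear span of the matrices `G_{y₀t, y₀t'}`, `t, t' ∈ U`. -/
noncomputable def gSpan (X : Type*) {Y : Type*} [Fintype X] [Fintype Y] [DecidableEq Y]
    (a b : Set (Y × Y) → Y) (U : Set (Set (Y × Y))) : Submodule ℂ (Matrix (X × Y) (X × Y) ℂ) :=
  Submodule.span ℂ {M | ∃ t ∈ U, ∃ t' ∈ U, M = gMat X a b t t'}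

/-- `V` is (contained in `A` and) a two-sided ideal of the algebra `A`, and as a `ℂ`-algebra it is
isomorphic to `Mat_U(ℂ)`: there is an injective `ℂ`-linear multiplicative map `Mat_U(ℂ) → A` with
image `V`. The map need not send the identity matrix to the identity of `A`. -/
def IsIdealIsoMat {Z ι : Type*} [Fintype Z] [DecidableEq Z] [Finite ι]
    (A : Subalgebra ℂ (Matrix Z Z ℂ)) (V : Submodule ℂ (Matrix Z Z ℂ)) (U : Set ι) : Prop :=
  letI : Fintype U := Fintype.ofFinite U
  ∃ I : TwoSidedIdeal A, (Subtype.val '' (I : Set A)) = (V : Set (Matrix Z Z ℂ)) ∧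
    ∃ φ : Matrix U U ℂ →ₙₐ[ℂ] A, Function.Injective φ ∧ Set.range φ = (I : Set A)

/-! ## Basic facts on schemes -/

section Scheme

variable {Y : Type*} {T : Set (Set (Y × Y))}

/-! For a set `U` of relations of valency 2 let `W` be the matrix with columns `w_t = 1_X ⊗ (e_{a t}
- e_{b t})`, `t ∈ U`. The sets `y₀t` are disjoint with two points each, so `Wᵀ W = 2|X| · 1`, and
`G_{y₀t, y₀t'} = (1 / 2|X|) w_t w_t'ᵀ`. Hence the `G` multiply as matrix units: `M ↦ (1 / 2|X|) W M
Wᵀ` is an injective multiplicative map onto their span. This span is an ideal once the `G` lie in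
the algebra and the column space of `W` is invariant under it (`isIdealIsoMat_of_conjLin`); the
generators are closed under transposition, so invariance from the left suffices.

Both conditions are governed by the `2 × 2` blocks `y₀t × y₀t'`. Each `σ_u` restricts there to a
constant or a permutation matrix (`IsScheme.block_iff`). If the block is full, i.e. inside one
relation, it annihilates the sign vector. Otherwise two relations split it into the two permutation
matrices, whose difference is `G` up to sign and scalar. So the `G` of non-full blocks lie in the
algebra, and invariance holds if `U` contains every `t` having a non-full block with some member of
`U`.

A full block forces `t^⊥ = t'^⊥` to be thin (`IsFullBlock.exists_orthogonal`). In (a), full blocks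
are therefore absent when `T^⊥ ⊆ T_2`, and are bypassed by `G_{t,t'} = G_{t,r} G_{r,t'}` with `r^⊥ ≠
t^⊥` when `|T^⊥| ≥ 2`. In (b), `Y_i` is a class of points mutually related by thin relations, blocks
inside a class are never full and blocks between classes always are, so `U_i` qualifies. -/

theorem IsCoherentConfiguration.exists_mem (hT : IsCoherentConfiguration T) (x y : Y) :
    ∃ s ∈ T, (x, y) ∈ s := by
  obtain ⟨s, ⟨hs, hxy⟩, -⟩ := hT.isPartition.2 (x, y)
  exact ⟨s, hs, hxy⟩

theorem IsCoherentConfiguration.eq_of_mem (hT : IsCoherentConfiguration T) {s t : Set (Y × Y)}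
    (hs : s ∈ T) (ht : t ∈ T) {x y : Y} (hxs : (x, y) ∈ s) (hxt : (x, y) ∈ t) : s = t :=
  (hT.isPartition.2 (x, y)).unique ⟨hs, hxs⟩ ⟨ht, hxt⟩

theorem mem_starRel {s : Set (Y × Y)} {x y : Y} : (x, y) ∈ starRel s ↔ (y, x) ∈ s := Iff.rfl

theorem mem_nbhd {s : Set (Y × Y)} {x y : Y} : y ∈ nbhd x s ↔ (x, y) ∈ s := Iff.rfl

theorem mem_idRel_univ {x y : Y} : (x, y) ∈ idRel (Set.univ : Set Y) ↔ x = y := by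
  simp [idRel]

theorem starRel_starRel (s : Set (Y × Y)) : starRel (starRel s) = s := rfl

/-- The condition `p_{st}^u ≠ 0` can be tested at any pair of `u`. -/
theorem IsCoherentConfiguration.exists_between [Finite Y] (hT : IsCoherentConfiguration T)
    {s t u : Set (Y × Y)} (hs : s ∈ T) (ht : t ∈ T) (hu : u ∈ T) {x y x' y' z : Y}
    (h : (x, y) ∈ u) (h' : (x', y') ∈ u) (hz : (x, z) ∈ s) (hz' : (z, y) ∈ t) :
    ∃ w, (x', w) ∈ s ∧ (w, y') ∈ t := by
  have hc := hT.intersection_number s hs t ht u hu x y x' y' h h'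
  have hpos : 0 < {z : Y | (x, z) ∈ s ∧ (z, y) ∈ t}.ncard :=
    (Set.ncard_pos (Set.toFinite _)).2 ⟨z, hz, hz'⟩
  rw [hc, Set.ncard_pos (Set.toFinite _)] at hpos
  exact hpos

theorem IsScheme.ne_of_mem (hT : IsScheme T) {s : Set (Y × Y)} (hs : s ∈ T)
    (h1 : s ≠ idRel Set.univ) {x y : Y} (h : (x, y) ∈ s) : x ≠ y := fun hxy =>
  h1 (hT.eq_of_mem hs hT.one_mem h (mem_idRel_univ.2 hxy))

theorem ne_idRel_of_mem {s : Set (Y × Y)} {x y : Y} (h : (x, y) ∈ s)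
    (hxy : x ≠ y) : s ≠ idRel Set.univ := by
  rintro rfl
  exact hxy (mem_idRel_univ.1 h)

theorem IsScheme.ncard_nbhd_eq (hT : IsScheme T) {s : Set (Y × Y)} (hs : s ∈ T) (x y : Y) :
    (nbhd x s).ncard = (nbhd y s).ncard := by
  have := hT.intersection_number s hs _ (hT.starRel_mem s hs) _ hT.one_mem x x y y
    (mem_idRel_univ.2 rfl) (mem_idRel_univ.2 rfl)
  simpa [mem_starRel, nbhd] using this

theorem sum_ncard_nbhd [Fintype Y] (s : Set (Y × Y)) :
    ∑ x, (nbhd x s).ncard = s.ncard := by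
  classical
  have h : ∀ x, (nbhd x s).ncard = ∑ y, if (x, y) ∈ s then 1 else 0 := fun x => by
    rw [Set.ncard_eq_toFinset_card', ← Finset.sum_filter, ← Finset.card_eq_sum_ones]
    congr 1
    ext y
    simp [mem_nbhd]
  simp_rw [h]
  rw [← Fintype.sum_prod_type', Set.ncard_eq_toFinset_card', ← Finset.sum_filter,
    ← Finset.card_eq_sum_ones]
  congr 1
  ext y
  simp

theorem ncard_starRel (s : Set (Y × Y)) : (starRel s).ncard = s.ncard := by
  have : starRel s = Prod.swap '' s := by
    ext ⟨x, y⟩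
    simp [mem_starRel]
  rw [this, Set.ncard_image_of_injective _ Prod.swap_injective]

/-- Counting the pairs of `s` by rows and by columns gives the same total, and all columns have
equal size. -/
theorem IsScheme.starRel_mem_relsOfValency [Finite Y] (hT : IsScheme T) {s : Set (Y × Y)} {k : ℕ}
    (hs : s ∈ relsOfValency T k) : starRel s ∈ relsOfValency T k := by
  have := Fintype.ofFinite Y
  refine ⟨hT.starRel_mem s hs.1, fun x => ?_⟩
  have h := (sum_ncard_nbhd (starRel s)).trans ((ncard_starRel s).trans (sum_ncard_nbhd s).symm)
  simp_rw [hs.2, fun y => hT.ncard_nbhd_eq (hT.starRel_mem s hs.1) y x] at h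
  have : Nonempty Y := ⟨x⟩
  simpa using h

theorem nbhd_subsingleton {s : Set (Y × Y)} (hs : s ∈ relsOfValency T 1) {x y z : Y}
    (hy : (x, y) ∈ s) (hz : (x, z) ∈ s) : y = z := by
  obtain ⟨w, hw⟩ := Set.ncard_eq_one.1 (hs.2 x)
  have h1 : y ∈ nbhd x s := hy
  have h2 : z ∈ nbhd x s := hz
  simp_all

theorem exists_nbhd_eq_pair {s : Set (Y × Y)} (hs : s ∈ relsOfValency T 2) {x y : Y}
    (hy : (x, y) ∈ s) : ∃ z, y ≠ z ∧ nbhd x s = {y, z} := by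
  obtain ⟨v, w, hne, hw⟩ := Set.ncard_eq_two.1 (hs.2 x)
  have h1 : y ∈ nbhd x s := hy
  rw [hw] at h1
  rcases h1 with rfl | rfl
  · exact ⟨w, hne, hw⟩
  · exact ⟨v, hne.symm, by rw [hw, Set.pair_comm]⟩

theorem exists_mem_of_relsOfValency_two {s : Set (Y × Y)} (hs : s ∈ relsOfValency T 2) (x : Y) :
    ∃ y, (x, y) ∈ s := by
  obtain ⟨v, w, -, hw⟩ := Set.ncard_eq_two.1 (hs.2 x)
  exact ⟨v, mem_nbhd.1 (hw ▸ Set.mem_insert v _)⟩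

theorem IsScheme.ne_of_mem_relsOfValency_two [Finite Y] (hT : IsScheme T) {s : Set (Y × Y)}
    (hs : s ∈ relsOfValency T 2) {x y : Y} (h : (x, y) ∈ s) : x ≠ y := by
  refine hT.ne_of_mem hs.1 ?_ h
  rintro rfl
  obtain ⟨z, hz, hn⟩ := exists_nbhd_eq_pair hs h
  have h2 : z ∈ nbhd x (idRel Set.univ) := by rw [hn]; simp
  exact hz ((mem_idRel_univ.1 h).symm.trans (mem_idRel_univ.1 (mem_nbhd.1 h2)))

theorem IsScheme.exists_starNbhd_pair [Finite Y] (hT : IsScheme T) {s : Set (Y × Y)}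
    (hs : s ∈ relsOfValency T 2) {x z : Y} (hz : (x, z) ∈ s) :
    ∃ y, x ≠ y ∧ ∀ w, (w, z) ∈ s ↔ w = x ∨ w = y := by
  obtain ⟨y, hy, hn⟩ := exists_nbhd_eq_pair (hT.starRel_mem_relsOfValency hs) (mem_starRel.2 hz)
  refine ⟨y, hy, fun w => ?_⟩
  have : w ∈ nbhd z (starRel s) ↔ w = x ∨ w = y := by rw [hn]; simp
  exact this

/-- For `t` of valency `2` there is a non-identity symmetric `u` with `t t* = {1, u}`. -/
theorem IsScheme.exists_orthogonal [Finite Y] [Nonempty Y] (hT : IsScheme T) {t : Set (Y × Y)}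
    (ht : t ∈ relsOfValency T 2) :
    ∃ u ∈ T, u ≠ idRel Set.univ ∧ starRel u = u ∧
      (∀ x y z, x ≠ y → (x, z) ∈ t → (y, z) ∈ t → (x, y) ∈ u) ∧
      complexProd T t (starRel t) = {idRel Set.univ, u} := by
  obtain ⟨x⟩ := ‹Nonempty Y›
  obtain ⟨z, hz⟩ := exists_mem_of_relsOfValency_two ht x
  obtain ⟨y, hxy, hy⟩ := hT.exists_starNbhd_pair ht hz
  have hyz : (y, z) ∈ t := (hy y).2 (Or.inr rfl)
  obtain ⟨u, hu, hxyu⟩ := hT.exists_mem x y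
  have hu1 := ne_idRel_of_mem hxyu hxy
  have key : ∀ x y z, x ≠ y → (x, z) ∈ t → (y, z) ∈ t → (x, y) ∈ u := by
    intro x' y' z' hne h1 h2
    -- The path `x, y, z` is transported to the pair `(x', z')`. Only two points are `t`-related to
    -- `z'`, and `w ≠ x'` is one of them, so `w = y'`.
    obtain ⟨w, hw, hw'⟩ := hT.exists_between hu ht.1 ht.1 hz h1 hxyu hyz
    obtain ⟨v, hv, hn⟩ := hT.exists_starNbhd_pair ht h1
    have hwx := hT.ne_of_mem hu hu1 hw
    have e1 := (hn w).1 hw'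
    have e2 := (hn y').1 h2
    grind
  refine ⟨u, hu, hu1, ?_, key, ?_⟩
  · exact hT.eq_of_mem (hT.starRel_mem u hu) hu (x := y) (y := x) hxyu
      (key y x z hxy.symm hyz hz)
  · ext v
    constructor
    · rintro ⟨hv, x', y', h, z', h1, h2⟩
      by_cases hne : x' = y'
      · exact Or.inl (hT.eq_of_mem hv hT.one_mem h (mem_idRel_univ.2 hne))
      · exact Or.inr (hT.eq_of_mem hv hu h (key x' y' z' hne h1 h2))
    · rintro (rfl | rfl)
      · exact ⟨hT.one_mem, x, x, mem_idRel_univ.2 rfl, z, hz, hz⟩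
      · exact ⟨hu, x, y, hxyu, z, hz, hyz⟩

/-! ## Blocks between the neighbourhoods of a point -/

/-- The block `y₀t × y₀t'` is contained in a single relation. -/
def IsFullBlock (T : Set (Set (Y × Y))) (y₀ : Y) (t t' : Set (Y × Y)) : Prop :=
  ∃ u ∈ T, ∀ z z', (y₀, z) ∈ t → (y₀, z') ∈ t' → (z, z') ∈ u

/-- Seen from `y₀`, both points of `y₀t'` are `u`-neighbours of `z`, so the intersection number
equals the valency of `u`. Seen from `y₁` it must then also exhaust `zu = y₀t'`. -/
theorem IsScheme.nbhd_subset_of_block [Finite Y] (hT : IsScheme T) {y₀ : Y} {t t' u : Set (Y × Y)}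
    (ht : t ∈ T) (ht' : t' ∈ relsOfValency T 2) (hu : u ∈ relsOfValency T 2)
    (h : ∀ z z', (y₀, z) ∈ t → (y₀, z') ∈ t' → (z, z') ∈ u) {y₁ z : Y} (hz : (y₀, z) ∈ t)
    (hz1 : (y₁, z) ∈ t) : ∀ z', (y₀, z') ∈ t' → (y₁, z') ∈ t' := by
  have hc := hT.intersection_number t' ht'.1 (starRel u) (hT.starRel_mem u hu.1) t ht
    y₀ z y₁ z hz hz1
  have hsub : ∀ y, {w | (y, w) ∈ t' ∧ (w, z) ∈ starRel u} ⊆ nbhd z u := fun y w hw => hw.2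
  have e0 : {w | (y₀, w) ∈ t' ∧ (w, z) ∈ starRel u} = nbhd y₀ t' := by
    ext w
    exact ⟨fun hw => hw.1, fun hw => ⟨hw, h z w hz hw⟩⟩
  have e1 : {w | (y₁, w) ∈ t' ∧ (w, z) ∈ starRel u} = nbhd z u := by
    refine Set.eq_of_subset_of_ncard_le (hsub y₁) ?_ (Set.toFinite _)
    rw [← hc, e0, hu.2, ht'.2]
  intro z' hz'
  have : z' ∈ nbhd z u := h z z' hz hz'
  rw [← e1] at this
  exact this.1

/-- If the block `y₀t × y₀t'` is contained in a single relation, then `t^⊥ = t'^⊥` is thin. -/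
theorem IsFullBlock.exists_orthogonal [Finite Y] (hT : IsQuasiThin T) {y₀ : Y}
    {t t' : Set (Y × Y)} (ht : t ∈ relsOfValency T 2) (ht' : t' ∈ relsOfValency T 2)
    (hf : IsFullBlock T y₀ t t') :
    ∃ w ∈ relsOfValency T 1, complexProd T t (starRel t) = {idRel Set.univ, w} ∧
      complexProd T t' (starRel t') = {idRel Set.univ, w} := by
  obtain ⟨hS, hTe⟩ := hT
  have : Nonempty Y := ⟨y₀⟩
  obtain ⟨u, hu, h⟩ := hf
  obtain ⟨z, hz⟩ := exists_mem_of_relsOfValency_two ht y₀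
  obtain ⟨z', hz'⟩ := exists_mem_of_relsOfValency_two ht' y₀
  obtain ⟨z2', hne, hn⟩ := exists_nbhd_eq_pair ht' hz'
  have hz2 : (y₀, z2') ∈ t' := mem_nbhd.1 (by rw [hn]; simp)
  have hu2 : u ∈ relsOfValency T 2 := by
    rw [hTe] at hu
    rcases hu with hu | hu
    · exact absurd (nbhd_subsingleton hu (h z z' hz hz') (h z z2' hz hz2)) hne
    · exact hu
  -- The second point with `z` as a `t`-neighbour has the same `t`- and `t'`-neighbourhoods as `y₀`,
  -- so `(y₀, y₁)` lies in both orthogonals.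
  obtain ⟨y₁, hy01, hy1⟩ := hS.exists_starNbhd_pair ht hz
  have hy1z : (y₁, z) ∈ t := (hy1 y₁).2 (Or.inr rfl)
  have h1 := hS.nbhd_subset_of_block ht.1 ht' hu2 h hz hy1z
  have h2 := hS.nbhd_subset_of_block ht'.1 ht (hS.starRel_mem_relsOfValency hu2)
    (fun z' z hz' hz => h z z' hz hz') hz' (h1 z' hz')
  obtain ⟨w, hw, hw1, -, key, hwt⟩ := hS.exists_orthogonal ht
  obtain ⟨w', hw', hw1', -, key', hwt'⟩ := hS.exists_orthogonal ht'
  have hm := key _ _ _ hy01 hz hy1z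
  have hm' := key' _ _ _ hy01 hz' (h1 z' hz')
  obtain rfl := hS.eq_of_mem hw hw' hm hm'
  refine ⟨w, ?_, hwt, hwt'⟩
  have hw12 := hw
  rw [hTe] at hw12
  refine hw12.resolve_right fun hwv => ?_
  -- If `w` had valency 2, the second point `y2` of `y₀w` would also share all of `y₀t` with `y₀`,
  -- giving `z` three points `t`-related to it.
  obtain ⟨y2, hy2, hny2⟩ := exists_nbhd_eq_pair hwv hm
  have hm2 : (y₀, y2) ∈ w := mem_nbhd.1 (by rw [hny2]; simp)
  have hc := hS.intersection_number t ht.1 _ (hS.starRel_mem t ht.1) w hw y₀ y₁ y₀ y2 hm hm2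
  have e : {v | (y₀, v) ∈ t ∧ (v, y₁) ∈ starRel t} = nbhd y₀ t := by
    ext v
    exact ⟨fun hv => hv.1, fun hv => ⟨hv, h2 v hv⟩⟩
  have e2 : {v | (y₀, v) ∈ t ∧ (v, y2) ∈ starRel t} = nbhd y₀ t :=
    Set.eq_of_subset_of_ncard_le (fun v hv => hv.1) (by rw [← hc, e]) (Set.toFinite _)
  have hz3 : z ∈ nbhd y₀ t := hz
  rw [← e2] at hz3
  rcases (hy1 y2).1 hz3.2 with h3 | h3
  · exact hS.ne_of_mem hw hw1 hm2 h3.symm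
  · exact hy2 h3.symm

/-! ## Schemes with a single thin orthogonal -/

/-- `y` and `z` are in a relation of valency `1`. -/
def ThinlyRelated (T : Set (Set (Y × Y))) (y z : Y) : Prop :=
  ∃ s ∈ relsOfValency T 1, (y, z) ∈ s

theorem IsScheme.thinlyRelated_symm [Finite Y] (hT : IsScheme T) {y z : Y}
    (h : ThinlyRelated T y z) : ThinlyRelated T z y := by
  obtain ⟨s, hs, h⟩ := h
  exact ⟨_, hT.starRel_mem_relsOfValency hs, h⟩

theorem IsQuasiThin.thinlyRelated_or [Finite Y] (hT : IsQuasiThin T) (y z : Y) :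
    ThinlyRelated T y z ∨ ∃ s ∈ relsOfValency T 2, (y, z) ∈ s := by
  obtain ⟨s, hs, h⟩ := hT.1.exists_mem y z
  rw [hT.2] at hs
  exact hs.imp (fun hs => ⟨s, hs, h⟩) fun hs => ⟨s, hs, h⟩

/-- Otherwise both points of a neighbourhood `xu` of size 2 would be reached from `x` by the same
two thin steps, which determine their endpoint. -/
theorem IsQuasiThin.thinlyRelated_trans [Finite Y] (hT : IsQuasiThin T) {x y z : Y}
    (h : ThinlyRelated T x y) (h' : ThinlyRelated T y z) : ThinlyRelated T x z := by
  refine (hT.thinlyRelated_or x z).resolve_right ?_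
  rintro ⟨u, hu, hxz⟩
  obtain ⟨s, hs, hxy⟩ := h
  obtain ⟨s', hs', hyz⟩ := h'
  obtain ⟨v, hv, hn⟩ := exists_nbhd_eq_pair hu hxz
  have hxv : (x, v) ∈ u := mem_nbhd.1 (by rw [hn]; simp)
  obtain ⟨w, h1, h2⟩ := hT.1.exists_between hs.1 hs'.1 hu.1 hxz hxv hxy hyz
  obtain rfl := nbhd_subsingleton hs hxy h1
  exact hv (nbhd_subsingleton hs' hyz h2)

theorem IsScheme.mem_of_orthogonals_eq [Finite Y] (hT : IsScheme T) {h : Set (Y × Y)}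
    (ho : orthogonals T = {h}) {t : Set (Y × Y)} (ht : t ∈ relsOfValency T 2) {x y z : Y}
    (hne : x ≠ y) (h1 : (x, z) ∈ t) (h2 : (y, z) ∈ t) : (x, y) ∈ h := by
  have : Nonempty Y := ⟨x⟩
  obtain ⟨u, hu, -, -, key, hc⟩ := hT.exists_orthogonal ht
  have : u ∈ orthogonals T := ⟨hu, t, ht, hc⟩
  rw [ho] at this
  obtain rfl : u = h := this
  exact key _ _ _ hne h1 h2

/-- The two points of `xt` share the `t*`-neighbour `x`, so they are related by `(t*)^⊥ = h`, and
`h` is thin. -/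
theorem IsScheme.nbhd_eq_of_orthogonals_eq [Finite Y] (hT : IsScheme T) {h : Set (Y × Y)}
    (ho : orthogonals T = {h}) (h1 : h ∈ relsOfValency T 1) {t : Set (Y × Y)}
    (ht : t ∈ relsOfValency T 2) {x y z : Y} (hxy : (x, y) ∈ t) :
    (x, z) ∈ t ↔ y = z ∨ (y, z) ∈ h := by
  have ht' := hT.starRel_mem_relsOfValency ht
  obtain ⟨w, hw, hn⟩ := exists_nbhd_eq_pair ht hxy
  have hxw : (x, w) ∈ t := mem_nbhd.1 (by rw [hn]; simp)
  constructor
  · intro hxz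
    by_cases hyz : y = z
    · exact Or.inl hyz
    · exact Or.inr (hT.mem_of_orthogonals_eq ho ht' (z := x) hyz hxy hxz)
  · rintro (rfl | hz)
    · exact hxy
    · have hwh := hT.mem_of_orthogonals_eq ho ht' (z := x) hw hxy hxw
      exact nbhd_subsingleton h1 hwh hz ▸ hxw

theorem IsScheme.orthogonal_ne_and_symm [Finite Y] [Nonempty Y] (hT : IsScheme T)
    {h : Set (Y × Y)} (ho : orthogonals T = {h}) : h ≠ idRel Set.univ ∧ starRel h = h := by
  have hh : h ∈ orthogonals T := by rw [ho]; rfl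
  obtain ⟨-, t, ht, -⟩ := hh
  obtain ⟨u, hu, hu1, hs, -, hc⟩ := hT.exists_orthogonal ht
  have : u ∈ orthogonals T := ⟨hu, t, ht, hc⟩
  rw [ho] at this
  obtain rfl : u = h := this
  exact ⟨hu1, hs⟩

theorem mem_coset {h : Set (Y × Y)} {y z : Y} :
    z ∈ (⋃ s ∈ ({idRel Set.univ} ∪ {h} : Set (Set (Y × Y))), nbhd y s) ↔ y = z ∨ (y, z) ∈ h := by
  simp [mem_nbhd, mem_idRel_univ, or_comm]

/-- The fibers are the cosets of `{1, h}`. -/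
theorem IsScheme.mem_fibers [Finite Y] [Nonempty Y] (hT : IsScheme T) {h : Set (Y × Y)}
    (ho : orthogonals T = {h}) (h1 : h ∈ relsOfValency T 1) {Δ : Set Y} :
    Δ ∈ fibers (residueExtension T ({idRel Set.univ} ∪ orthogonals T)) ↔
      ∃ δ, Δ = {z | δ = z ∨ (δ, z) ∈ h} := by
  obtain ⟨hne, hsymm⟩ := hT.orthogonal_ne_and_symm ho
  have hsw : ∀ {x y}, (x, y) ∈ h → (y, x) ∈ h := fun {x y} hx => by
    rw [← hsymm] at hx; exact hx
  have hself : ∀ {A : Set Y} {x}, (x, x) ∈ idRel A ↔ x ∈ A := by simp [idRel]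
  rw [ho]
  constructor
  · rintro ⟨⟨⟨x, x'⟩, hx⟩, s, hs, _, ⟨y, rfl⟩, _, ⟨y', rfl⟩, he⟩
    obtain ⟨hxΔ, rfl : x = x'⟩ := hx
    have hxs : (x, x) ∈ s ∩ _ := he ▸ (hself.2 hxΔ)
    obtain rfl := hT.eq_of_mem hs hT.one_mem hxs.1 (mem_idRel_univ.2 rfl)
    have h2 := mem_coset.1 hxs.2.1
    have h3 := mem_coset.1 hxs.2.2
    refine ⟨x, Set.ext fun z => ?_⟩
    have hz : z ∈ Δ ↔ (y = z ∨ (y, z) ∈ h) ∧ (y' = z ∨ (y', z) ∈ h) := by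
      rw [← hself, he, Set.mem_inter_iff, Set.mem_prod, mem_coset, mem_coset]
      exact and_iff_right (mem_idRel_univ.2 rfl)
    rw [hz]
    -- As a thin symmetric relation `h` is an involution, so cosets of `{1, h}` that meet coincide.
    have hcos : ∀ v, v = x ∨ (v, x) ∈ h → ((v = z ∨ (v, z) ∈ h) ↔ (x = z ∨ (x, z) ∈ h)) := by
      rintro v (rfl | hv)
      · rfl
      · constructor
        · rintro (rfl | hv')
          · exact Or.inr (hsw hv)
          · exact Or.inl (nbhd_subsingleton h1 hv hv')
        · rintro (rfl | hv')
          · exact Or.inr hv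
          · exact Or.inl (nbhd_subsingleton h1 (hsw hv) hv')
    rw [hcos y h2, hcos y' h3, and_self]
    rfl
  · rintro ⟨δ, rfl⟩
    refine ⟨⟨(δ, δ), hself.2 (Or.inl rfl)⟩, idRel Set.univ, hT.one_mem, _, ⟨δ, rfl⟩, _,
      ⟨δ, rfl⟩, ?_⟩
    ext ⟨x, y⟩
    simp only [Set.mem_inter_iff, Set.mem_prod, mem_coset, mem_idRel_univ]
    constructor
    · rintro ⟨hx, rfl : x = y⟩
      exact ⟨rfl, hx, hx⟩
    · rintro ⟨rfl, hx, -⟩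
      exact ⟨hx, rfl⟩

/-- Relations of valency `2` are unions of full blocks between cosets of `{1, h}`. -/
theorem IsScheme.mem_of_coset [Finite Y] (hT : IsScheme T) {h : Set (Y × Y)}
    (ho : orthogonals T = {h}) (h1 : h ∈ relsOfValency T 1) {s : Set (Y × Y)}
    (hs : s ∈ relsOfValency T 2) {x y x' y' : Y} (hxy : (x, y) ∈ s) (hx : x = x' ∨ (x, x') ∈ h)
    (hy : y = y' ∨ (y, y') ∈ h) : (x', y') ∈ s :=
  (hT.nbhd_eq_of_orthogonals_eq ho h1 (hT.starRel_mem_relsOfValency hs) (x := y')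
    ((hT.nbhd_eq_of_orthogonals_eq ho h1 hs hxy).2 hy : (y', x) ∈ starRel s)).2 hx

/-- The set `Y_i` consists of the points thinly related to a given point. -/
theorem IsQuasiThin.exists_sUnion_fiberClass [Finite Y] [Nonempty Y] (hT : IsQuasiThin T)
    {h : Set (Y × Y)} (ho : orthogonals T = {h}) (h1 : h ∈ relsOfValency T 1) {i : Set (Set Y)}
    (hi : i ∈ fiberClasses T) : ∃ δ, ∀ y, y ∈ ⋃₀ i ↔ ThinlyRelated T δ y := by
  obtain ⟨hne, hsymm⟩ := hT.1.orthogonal_ne_and_symm ho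
  obtain ⟨Δ, hΔ, rfl⟩ := hi
  obtain ⟨δ, rfl⟩ := (hT.1.mem_fibers ho h1).1 hΔ
  -- A thin relation meets a row of the block in one point, whereas a coset has two; a relation of
  -- valency 2 fills the block by `mem_of_coset`.
  have hthin : ∀ x y, ThinlyRelated T x y ↔ {z | x = z ∨ (x, z) ∈ h} ×ˢ {z | y = z ∨ (y, z) ∈ h} ∉
      residueExtension T ({idRel Set.univ} ∪ orthogonals T) := by
    intro x y
    constructor
    · rintro ⟨s, hs, hxy⟩ ⟨-, u, hu, A, hA, B, hB, he⟩
      obtain ⟨v, hv⟩ : (nbhd y h).Nonempty := by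
        rw [← Set.ncard_pos, h1.2]
        exact one_pos
      have m1 : (x, y) ∈ u ∩ A ×ˢ B := he ▸ ⟨Or.inl rfl, Or.inl rfl⟩
      have m2 : (x, v) ∈ u ∩ A ×ˢ B := he ▸ ⟨Or.inl rfl, Or.inr hv⟩
      obtain rfl := hT.1.eq_of_mem hs.1 hu hxy m1.1
      exact hT.1.ne_of_mem h1.1 hne hv (nbhd_subsingleton hs m1.1 m2.1)
    · intro hn
      refine (hT.thinlyRelated_or x y).resolve_right ?_
      rintro ⟨s, hs, hxy⟩
      refine hn ⟨⟨(x, y), Or.inl rfl, Or.inl rfl⟩, s, hs.1, _, ⟨x, rfl⟩, _, ⟨y, rfl⟩, ?_⟩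
      ext ⟨x', y'⟩
      simp only [Set.mem_inter_iff, Set.mem_prod, ho, mem_coset, Set.mem_ofPred_eq]
      exact ⟨fun hh => ⟨hT.1.mem_of_coset ho h1 hs hxy hh.1 hh.2, hh⟩, fun hh => hh.2⟩
  refine ⟨δ, fun y => ?_⟩
  constructor
  · rintro ⟨Γ, ⟨hΓ, hn⟩, hy⟩
    obtain ⟨γ, rfl⟩ := (hT.1.mem_fibers ho h1).1 hΓ
    have hγ := (hthin δ γ).2 hn
    rcases hy with rfl | hy
    · exact hγ
    · exact hT.thinlyRelated_trans hγ ⟨h, h1, hy⟩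
  · intro hy
    exact ⟨_, ⟨(hT.1.mem_fibers ho h1).2 ⟨y, rfl⟩, (hthin δ y).1 hy⟩, Or.inl rfl⟩

theorem not_isFullBlock_of_thinlyRelated (hT : IsScheme T) {y₀ : Y} {t t' : Set (Y × Y)}
    (ht' : t' ∈ relsOfValency T 2) {z z' : Y} (hz : (y₀, z) ∈ t)
    (hz' : (y₀, z') ∈ t') (h : ThinlyRelated T z z') : ¬IsFullBlock T y₀ t t' := by
  rintro ⟨u, hu, hf⟩
  obtain ⟨s, hs, hzs⟩ := h
  obtain rfl := hT.eq_of_mem hs.1 hu hzs (hf _ _ hz hz')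
  obtain ⟨v, hv, hn⟩ := exists_nbhd_eq_pair ht' hz'
  exact hv (nbhd_subsingleton hs hzs (hf _ _ hz (mem_nbhd.1 (by rw [hn]; simp))))

/-- Points of `y₀t` and `y₀t'` that are not thinly related lie in a relation of valency 2, which
fills the whole block of cosets. This is the closure condition that makes the span for `U_i` an
ideal. -/
theorem IsQuasiThin.mem_relsOfClass_of_not_isFullBlock [Finite Y] (hT : IsQuasiThin T) {y₀ : Y}
    {h : Set (Y × Y)} (ho : orthogonals T = {h}) (h1 : h ∈ relsOfValency T 1) {i : Set (Set Y)}
    (hi : i ∈ fiberClasses T) {t t' : Set (Y × Y)} (ht : t ∈ relsOfValency T 2)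
    (ht' : t' ∈ relsOfClass T y₀ i) (hn : ¬IsFullBlock T y₀ t t') :
    t ∈ relsOfClass T y₀ i := by
  have : Nonempty Y := ⟨y₀⟩
  obtain ⟨δ, hδ⟩ := hT.exists_sUnion_fiberClass ho h1 hi
  refine ⟨ht, fun z hz => (hδ z).2 ?_⟩
  obtain ⟨z', hz'⟩ := exists_mem_of_relsOfValency_two ht'.1 y₀
  refine hT.thinlyRelated_trans ((hδ z').1 (ht'.2 hz')) (hT.1.thinlyRelated_symm ?_)
  refine (hT.thinlyRelated_or z z').resolve_right ?_
  rintro ⟨s, hs, hzs⟩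
  exact hn ⟨s, hs.1, fun w w' hw hw' => hT.1.mem_of_coset ho h1 hs hzs
    ((hT.1.nbhd_eq_of_orthogonals_eq ho h1 ht hz).1 hw)
    ((hT.1.nbhd_eq_of_orthogonals_eq ho h1 ht'.1 hz').1 hw')⟩

theorem IsQuasiThin.not_isFullBlock_of_mem_relsOfClass [Finite Y] (hT : IsQuasiThin T) {y₀ : Y}
    {h : Set (Y × Y)} (ho : orthogonals T = {h}) (h1 : h ∈ relsOfValency T 1) {i : Set (Set Y)}
    (hi : i ∈ fiberClasses T) {t t' : Set (Y × Y)} (ht : t ∈ relsOfClass T y₀ i)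
    (ht' : t' ∈ relsOfClass T y₀ i) : ¬IsFullBlock T y₀ t t' := by
  have : Nonempty Y := ⟨y₀⟩
  obtain ⟨δ, hδ⟩ := hT.exists_sUnion_fiberClass ho h1 hi
  obtain ⟨z, hz⟩ := exists_mem_of_relsOfValency_two ht.1 y₀
  obtain ⟨z', hz'⟩ := exists_mem_of_relsOfValency_two ht'.1 y₀
  exact not_isFullBlock_of_thinlyRelated hT.1 ht'.1 hz hz' <|
    hT.thinlyRelated_trans (hT.1.thinlyRelated_symm ((hδ z).1 (ht.2 hz))) ((hδ z').1 (ht'.2 hz'))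

end Scheme

/-! ## Ideals spanned by matrix units -/

/-- The matrices `c W M Wᵀ`. -/
noncomputable def conjLin {Z U : Type*} [Fintype U] (c : ℂ) (W : Matrix Z U ℂ) :
    Matrix U U ℂ →ₗ[ℂ] Matrix Z Z ℂ where
  toFun M := c • (W * M * W.transpose)
  map_add' M N := by rw [Matrix.mul_add, Matrix.add_mul, smul_add]
  map_smul' r M := by rw [Matrix.mul_smul, Matrix.smul_mul, smul_comm]; rfl

theorem conjLin_apply {Z U : Type*} [Fintype U] (c : ℂ) (W : Matrix Z U ℂ) (M : Matrix U U ℂ) :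
    conjLin c W M = c • (W * M * W.transpose) := rfl

theorem conjLin_single_apply {Z U : Type*} [Fintype U] [DecidableEq U] (c : ℂ)
    (W : Matrix Z U ℂ) (t t' : U) (i j : Z) :
    conjLin c W (Matrix.single t t' 1) i j = c * (W i t * W j t') := by
  simp [conjLin_apply, Matrix.mul_apply, Matrix.single_apply, ite_and, Finset.sum_ite_eq,
    Matrix.transpose_apply]

theorem conjLin_mul {Z U : Type*} [Fintype Z] [Fintype U] [DecidableEq U] {c : ℂ} (hc : c ≠ 0)
    {W : Matrix Z U ℂ} (hW : W.transpose * W = c⁻¹ • (1 : Matrix U U ℂ)) (M N : Matrix U U ℂ) :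
    conjLin c W (M * N) = conjLin c W M * conjLin c W N := by
  have : W * M * W.transpose * (W * N * W.transpose) =
      W * M * (W.transpose * W) * (N * W.transpose) := by simp only [Matrix.mul_assoc]
  rw [conjLin_apply, conjLin_apply, conjLin_apply, Matrix.smul_mul, Matrix.mul_smul, this, hW,
    Matrix.mul_smul, Matrix.smul_mul, Matrix.mul_one, smul_smul c c⁻¹, mul_inv_cancel₀ hc,
    one_smul]
  simp only [Matrix.mul_assoc]

theorem conjLin_injective {Z U : Type*} [Fintype Z] [Fintype U] [DecidableEq U] {c : ℂ}
    (hc : c ≠ 0) {W : Matrix Z U ℂ} (hW : W.transpose * W = c⁻¹ • (1 : Matrix U U ℂ)) :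
    Function.Injective (conjLin c W) := by
  -- An explicit left inverse: the two factors `Wᵀ W` contribute `c⁻¹` each, cancelled by `c` here
  -- and `c` in `conjLin`.
  have key : ∀ M, c • (W.transpose * conjLin c W M * W) = M := fun M => by
    have : W.transpose * (W * M * W.transpose) * W =
        (W.transpose * W) * M * (W.transpose * W) := by simp only [Matrix.mul_assoc]
    rw [conjLin_apply, Matrix.mul_smul, Matrix.smul_mul, this, hW]
    simp [smul_smul, hc]
  intro M N h
  rw [← key M, ← key N, h]

theorem range_conjLin {Z U : Type*} [Fintype U] [DecidableEq U] (c : ℂ) (W : Matrix Z U ℂ) :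
    LinearMap.range (conjLin c W) =
      Submodule.span ℂ {M | ∃ t t', M = conjLin c W (Matrix.single t t' 1)} := by
  apply le_antisymm
  · rintro _ ⟨M, rfl⟩
    rw [Matrix.matrix_eq_sum_single M, map_sum]
    refine Submodule.sum_mem _ fun t _ => ?_
    rw [map_sum]
    refine Submodule.sum_mem _ fun t' _ => ?_
    rw [← mul_one (M t t'), ← smul_eq_mul, ← Matrix.smul_single, map_smul]
    exact Submodule.smul_mem _ _ (Submodule.subset_span ⟨t, t', rfl⟩)
  · rw [Submodule.span_le]
    rintro _ ⟨t, t', rfl⟩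
    exact ⟨_, rfl⟩

/-- If `Wᵀ W` is a scalar matrix and the column space of `W` is invariant under an algebra `A` and
its transpose, then the matrices `W M Wᵀ` form an ideal of `A` as soon as they lie in `A`. -/
theorem isIdealIsoMat_of_conjLin {Z ι : Type*} [Fintype Z] [DecidableEq Z] [Finite ι]
    {A : Subalgebra ℂ (Matrix Z Z ℂ)} {U : Set ι} [hU : Fintype U] [DecidableEq U]
    {W : Matrix Z U ℂ} {c : ℂ} (hc : c ≠ 0) (hW : W.transpose * W = c⁻¹ • (1 : Matrix U U ℂ))
    (hA : ∀ t t', conjLin c W (Matrix.single t t' 1) ∈ A)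
    (hl : ∀ g ∈ A, ∃ K : Matrix U U ℂ, g * W = W * K)
    (hr : ∀ g ∈ A, ∃ K : Matrix U U ℂ, W.transpose * g = K * W.transpose) :
    IsIdealIsoMat A (LinearMap.range (conjLin c W)) U := by
  obtain rfl : hU = Fintype.ofFinite U := Subsingleton.elim _ _
  let _ : Fintype U := Fintype.ofFinite U
  have hmem : ∀ M, conjLin c W M ∈ A := by
    have : LinearMap.range (conjLin c W) ≤ Subalgebra.toSubmodule A := by
      rw [range_conjLin, Submodule.span_le]
      rintro _ ⟨t, t', rfl⟩
      exact hA t t'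
    exact fun M => this ⟨M, rfl⟩
  let I : TwoSidedIdeal A := TwoSidedIdeal.mk'
    {x : A | (x : Matrix Z Z ℂ) ∈ LinearMap.range (conjLin c W)}
    ⟨0, map_zero _⟩ (by
      rintro x y ⟨M, hM⟩ ⟨N, hN⟩
      exact ⟨M + N, by rw [map_add, hM, hN]; rfl⟩)
    (by
      rintro x ⟨M, hM⟩
      exact ⟨-M, by rw [map_neg, hM]; rfl⟩)
    (by
      rintro x y ⟨M, hM⟩
      obtain ⟨K, hK⟩ := hl x x.2
      refine ⟨K * M, ?_⟩
      rw [MulMemClass.coe_mul, ← hM, conjLin_apply, conjLin_apply, Matrix.mul_smul,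
        ← Matrix.mul_assoc, ← Matrix.mul_assoc, ← Matrix.mul_assoc, hK])
    (by
      rintro x y ⟨M, hM⟩
      obtain ⟨K, hK⟩ := hr y y.2
      refine ⟨M * K, ?_⟩
      rw [MulMemClass.coe_mul, ← hM, conjLin_apply, conjLin_apply, Matrix.smul_mul,
        Matrix.mul_assoc (W * M), hK]
      simp only [Matrix.mul_assoc])
  have hI : (I : Set A) = {x : A | (x : Matrix Z Z ℂ) ∈ LinearMap.range (conjLin c W)} :=
    TwoSidedIdeal.coe_mk' ..
  refine ⟨I, ?_, ⟨⟨⟨fun M => ⟨conjLin c W M, hmem M⟩, ?_⟩, ?_, ?_⟩, ?_⟩, ?_, ?_⟩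
  · rw [hI]
    ext M
    constructor
    · rintro ⟨x, hx, rfl⟩
      exact hx
    · rintro ⟨M, rfl⟩
      exact ⟨⟨_, hmem M⟩, ⟨M, rfl⟩, rfl⟩
  · intro r M
    exact Subtype.ext (map_smul _ r M)
  · exact Subtype.ext (map_zero _)
  · intro M N
    exact Subtype.ext (map_add _ M N)
  · intro M N
    exact Subtype.ext (conjLin_mul hc hW M N)
  · intro M N h
    exact conjLin_injective hc hW (congrArg Subtype.val h)
  · rw [hI]
    ext x
    constructor
    · rintro ⟨M, rfl⟩
      exact ⟨M, rfl⟩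
    · rintro ⟨M, hM⟩
      exact ⟨M, Subtype.ext hM⟩

theorem exists_mul_eq_of_mem_adjoin {Z U : Type*} [Fintype Z] [DecidableEq Z] [Fintype U]
    [DecidableEq U] {gens : Set (Matrix Z Z ℂ)} {W : Matrix Z U ℂ}
    (h : ∀ g ∈ gens, ∃ K : Matrix U U ℂ, g * W = W * K) {g : Matrix Z Z ℂ}
    (hg : g ∈ Algebra.adjoin ℂ gens) : ∃ K : Matrix U U ℂ, g * W = W * K := by
  induction hg using Algebra.adjoin_induction with
  | mem x hx => exact h x hx
  | algebraMap r => exact ⟨r • 1, by simp [Algebra.algebraMap_eq_smul_one]⟩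
  | add x y _ _ hx hy =>
    obtain ⟨K, hK⟩ := hx
    obtain ⟨L, hL⟩ := hy
    exact ⟨K + L, by rw [Matrix.add_mul, hK, hL, Matrix.mul_add]⟩
  | mul x y _ _ hx hy =>
    obtain ⟨K, hK⟩ := hx
    obtain ⟨L, hL⟩ := hy
    exact ⟨K * L, by rw [Matrix.mul_assoc, hL, ← Matrix.mul_assoc, hK, Matrix.mul_assoc]⟩

theorem transpose_mem_adjoin {Z : Type*} [Fintype Z] [DecidableEq Z] {gens : Set (Matrix Z Z ℂ)}
    (h : ∀ g ∈ gens, g.transpose ∈ gens) {g : Matrix Z Z ℂ} (hg : g ∈ Algebra.adjoin ℂ gens) :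
    g.transpose ∈ Algebra.adjoin ℂ gens := by
  induction hg using Algebra.adjoin_induction with
  | mem x hx => exact Algebra.subset_adjoin (h x hx)
  | algebraMap r =>
    rw [Algebra.algebraMap_eq_smul_one, Matrix.transpose_smul, Matrix.transpose_one]
    exact Subalgebra.smul_mem _ (one_mem _) r
  | add x y _ _ hx hy =>
    rw [Matrix.transpose_add]
    exact add_mem hx hy
  | mul x y _ _ hx hy =>
    rw [Matrix.transpose_mul]
    exact mul_mem hy hx

/-! ## The Terwilliger algebra of a wreath product -/

section Wreath

variable {X Y : Type*} {S : Set (Set (X × X))} {T : Set (Set (Y × Y))}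

open Classical in
theorem adjMat_apply (s : Set (X × X)) (x y : X) :
    adjMat s x y = if (x, y) ∈ s then 1 else 0 := rfl

theorem starRel_mem_wreathProd (hS : IsScheme S) (hT : IsScheme T) {r : Set ((X × Y) × (X × Y))}
    (hr : r ∈ wreathProd S T) : starRel r ∈ wreathProd S T := by
  rcases hr with ⟨s, hs, rfl⟩ | ⟨t, ht, rfl⟩
  · refine Or.inl ⟨starRel s, hS.starRel_mem s hs, ?_⟩
    ext ⟨⟨x, y⟩, x', y'⟩
    simp [tildeRel, starRel, eq_comm]
  · refine Or.inr ⟨starRel t, ⟨hT.starRel_mem t ht.1, ?_⟩, rfl⟩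
    rintro (h : starRel t = _)
    refine ht.2 (show t = _ from ?_)
    rw [← starRel_starRel t, h]
    ext ⟨x, y⟩
    simp [starRel, idRel, eq_comm]

/-- The relation lifting `1_Y` is not in the wreath product, but it is the disjoint union of the
`s̃`. This puts its adjacency matrix in the algebra, where it is needed for blocks meeting the
diagonal. -/
theorem sum_adjMat_tildeRel [Fintype X] (hS : IsScheme S) :
    ∑ s ∈ (Set.toFinite S).toFinset, adjMat (tildeRel Y s) =
      adjMat (barRel X (idRel (Set.univ : Set Y))) := by
  classical
  ext ⟨x, y⟩ ⟨x', y'⟩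
  rw [Matrix.sum_apply]
  by_cases hy : y = y'
  · obtain ⟨s, hs, hxs⟩ := hS.exists_mem x x'
    rw [Finset.sum_eq_single s]
    · simp [adjMat_apply, tildeRel, barRel, idRel, hy, hxs]
    · intro r hr hne
      simp only [Set.Finite.mem_toFinset] at hr
      simp only [adjMat_apply, tildeRel, Set.mem_ofPred_eq]
      exact if_neg fun h => hne (hS.eq_of_mem hr hs h.1 hxs)
    · simp [hs]
  · simp [adjMat_apply, tildeRel, barRel, idRel, hy]

variable [Fintype X] [Fintype Y] [DecidableEq Y]

/-- The matrix with columns `1_X ⊗ (e_{a t} - e_{b t})`, `t ∈ U`. -/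
noncomputable def signMat (X : Type*) (a b : Set (Y × Y) → Y) (U : Set (Set (Y × Y))) :
    Matrix (X × Y) U ℂ :=
  Matrix.of fun z t => (if z.2 = a t then 1 else 0) - (if z.2 = b t then 1 else 0)

theorem gMat_eq_conjLin (a b : Set (Y × Y) → Y) {U : Set (Set (Y × Y))} [Fintype U]
    [DecidableEq U] (t t' : U) :
    gMat X a b t t' =
      conjLin (1 / (2 * (Fintype.card X : ℂ))) (signMat X a b U) (Matrix.single t t' 1) := by
  ext ⟨x, y⟩ ⟨x', y'⟩
  have h : ∀ p q : Y, blockOnes {p} {q} y y' =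
      (if y = p then 1 else 0) * (if y' = q then (1 : ℂ) else 0) := fun p q => by
    simp [blockOnes, diagMat, Matrix.diagonal_mul, Matrix.mul_diagonal, allOnes]
  rw [conjLin_single_apply, gMat, Matrix.smul_apply, Matrix.kroneckerMap_apply, Matrix.sub_apply,
    Matrix.sub_apply, Matrix.add_apply, h, h, h, h]
  simp only [allOnes, Matrix.of_apply, signMat, smul_eq_mul]
  ring

theorem gSpan_eq_range (a b : Set (Y × Y) → Y) (U : Set (Set (Y × Y))) [Fintype U]
    [DecidableEq U] :
    gSpan X a b U =
      LinearMap.range (conjLin (1 / (2 * (Fintype.card X : ℂ))) (signMat X a b U)) := by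
  rw [range_conjLin, gSpan]
  congr 1
  ext M
  constructor
  · rintro ⟨t, ht, t', ht', rfl⟩
    exact ⟨⟨t, ht⟩, ⟨t', ht'⟩, gMat_eq_conjLin a b (U := U) ⟨t, ht⟩ ⟨t', ht'⟩⟩
  · rintro ⟨t, t', rfl⟩
    exact ⟨t, t.2, t', t'.2, (gMat_eq_conjLin a b t t').symm⟩

variable [DecidableEq X]

theorem transpose_mem_terwilligerAlgebra (hS : IsScheme S) (hT : IsScheme T) (z : X × Y)
    {g : Matrix (X × Y) (X × Y) ℂ} (hg : g ∈ terwilligerAlgebra (wreathProd S T) z) :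
    g.transpose ∈ terwilligerAlgebra (wreathProd S T) z := by
  refine transpose_mem_adjoin ?_ hg
  rintro _ (⟨r, hr, rfl⟩ | ⟨r, hr, rfl⟩)
  · exact Or.inl ⟨_, starRel_mem_wreathProd hS hT hr, rfl⟩
  · exact Or.inr ⟨r, hr, (Matrix.diagonal_transpose _).symm⟩

theorem adjMat_barRel_mem (hS : IsScheme S) {t : Set (Y × Y)} (ht : t ∈ T) (z : X × Y) :
    adjMat (barRel X t) ∈ terwilligerAlgebra (wreathProd S T) z := by
  by_cases h1 : t = idRel Set.univ
  · rw [h1, ← sum_adjMat_tildeRel hS]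
    refine sum_mem fun s hs => Algebra.subset_adjoin (Or.inl ⟨_, Or.inl ⟨s, ?_, rfl⟩, rfl⟩)
    simpa using hs
  · exact Algebra.subset_adjoin (Or.inl ⟨_, Or.inr ⟨t, ⟨ht, h1⟩, rfl⟩, rfl⟩)

theorem diagMat_barRel_mem {t : Set (Y × Y)} (ht : t ∈ T) (h1 : t ≠ idRel Set.univ) (z : X × Y) :
    diagMat (nbhd z (barRel X t)) ∈ terwilligerAlgebra (wreathProd S T) z :=
  Algebra.subset_adjoin (Or.inr ⟨_, Or.inr ⟨t, ⟨ht, h1⟩, rfl⟩, rfl⟩)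

end Wreath

/-! ## The action on the sign vectors of the neighbourhoods of `y₀` -/

section SignVectors

variable {X Y : Type*} {S : Set (Set (X × X))} {T : Set (Set (Y × Y))} {y₀ : Y}
  {a b : Set (Y × Y) → Y}

theorem mem_iff_of_nbhd_eq (hab : ∀ t ∈ relsOfValency T 2, nbhd y₀ t = {a t, b t})
    {t : Set (Y × Y)} (ht : t ∈ relsOfValency T 2) {y : Y} : (y₀, y) ∈ t ↔ y = a t ∨ y = b t := by
  rw [← mem_nbhd, hab t ht]
  simp

theorem left_ne_right_of_nbhd_eq (hab : ∀ t ∈ relsOfValency T 2, nbhd y₀ t = {a t, b t})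
    {t : Set (Y × Y)} (ht : t ∈ relsOfValency T 2) : a t ≠ b t := by
  intro h
  have := ht.2 y₀
  rw [hab t ht, h] at this
  simp at this

open Classical in
theorem ncard_pair_inter {p q : Y} (hpq : p ≠ q) (P : Y → Prop) :
    {z | (z = p ∨ z = q) ∧ P z}.ncard = (if P p then 1 else 0) + (if P q then 1 else 0) := by
  have : {z | (z = p ∨ z = q) ∧ P z} = ({p, q} : Finset Y).filter P := by
    ext z
    simp
  rw [this, Set.ncard_coe_finset, Finset.card_filter, Finset.sum_pair hpq]

/-- A `2 × 2` block is a constant or a permutation matrix. -/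
theorem IsScheme.block_iff (hT : IsScheme T)
    (hab : ∀ t ∈ relsOfValency T 2, nbhd y₀ t = {a t, b t}) {t t' u : Set (Y × Y)}
    (ht : t ∈ relsOfValency T 2) (ht' : t' ∈ relsOfValency T 2) (hu : u ∈ T) :
    ((a t, a t') ∈ u ↔ (b t, b t') ∈ u) ∧ ((a t, b t') ∈ u ↔ (b t, a t') ∈ u) := by
  classical
  have hma := fun t ht => (mem_iff_of_nbhd_eq hab (t := t) ht).2 (Or.inl rfl)
  have hmb := fun t ht => (mem_iff_of_nbhd_eq hab (t := t) ht).2 (Or.inr rfl)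
  -- `h1` equates the two column sums of the block and `h2` the two row sums; a `2 × 2` matrix of
  -- zeros and ones with both properties is invariant under swapping both labels.
  have h1 := hT.intersection_number t ht.1 u hu t' ht'.1 _ _ _ _ (hma t' ht') (hmb t' ht')
  have h2 := hT.intersection_number t' ht'.1 _ (hT.starRel_mem u hu) t ht.1 _ _ _ _
    (hma t ht) (hmb t ht)
  simp only [mem_iff_of_nbhd_eq hab ht, mem_iff_of_nbhd_eq hab ht', mem_starRel] at h1 h2
  rw [ncard_pair_inter (left_ne_right_of_nbhd_eq hab ht),
    ncard_pair_inter (left_ne_right_of_nbhd_eq hab ht)] at h1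
  rw [ncard_pair_inter (left_ne_right_of_nbhd_eq hab ht'),
    ncard_pair_inter (left_ne_right_of_nbhd_eq hab ht')] at h2
  by_cases p1 : (a t, a t') ∈ u <;> by_cases p2 : (a t, b t') ∈ u <;>
    by_cases p3 : (b t, a t') ∈ u <;> by_cases p4 : (b t, b t') ∈ u <;>
    simp_all

variable [DecidableEq Y]

theorem signMat_apply {U : Set (Set (Y × Y))} (x : X) (y : Y) (t : U) :
    signMat X a b U (x, y) t = (if y = a t then 1 else 0) - (if y = b t then 1 else 0) := rfl

theorem signMat_apply_left (hab : ∀ t ∈ relsOfValency T 2, nbhd y₀ t = {a t, b t})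
    {U : Set (Set (Y × Y))} (hU : U ⊆ relsOfValency T 2) (x : X) (t : U) :
    signMat X a b U (x, a t) t = 1 := by
  simp [signMat_apply, left_ne_right_of_nbhd_eq hab (hU t.2)]

theorem signMat_apply_right (hab : ∀ t ∈ relsOfValency T 2, nbhd y₀ t = {a t, b t})
    {U : Set (Set (Y × Y))} (hU : U ⊆ relsOfValency T 2) (x : X) (t : U) :
    signMat X a b U (x, b t) t = -1 := by
  simp [signMat_apply, (left_ne_right_of_nbhd_eq hab (hU t.2)).symm]

theorem signMat_apply_eq_zero (hab : ∀ t ∈ relsOfValency T 2, nbhd y₀ t = {a t, b t})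
    {U : Set (Set (Y × Y))} (hU : U ⊆ relsOfValency T 2) (x : X) {y : Y} {t : U}
    (h : (y₀, y) ∉ t.1) : signMat X a b U (x, y) t = 0 := by
  rw [mem_iff_of_nbhd_eq hab (hU t.2), not_or] at h
  simp [signMat_apply, h.1, h.2]

variable [Fintype X] [Fintype Y]

theorem sum_mul_signMat {U : Set (Set (Y × Y))} (f : Y → ℂ) (t : U) :
    ∑ z : X × Y, f z.2 * signMat X a b U z t = Fintype.card X * (f (a t) - f (b t)) := by
  rw [Fintype.sum_prod_type]
  simp [signMat_apply, mul_sub, Finset.sum_sub_distrib]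

theorem signMat_transpose_mul (hT : IsScheme T)
    (hab : ∀ t ∈ relsOfValency T 2, nbhd y₀ t = {a t, b t}) [Nonempty X]
    {U : Set (Set (Y × Y))} [DecidableEq U] (hU : U ⊆ relsOfValency T 2) :
    (signMat X a b U).transpose * signMat X a b U =
      (1 / (2 * (Fintype.card X : ℂ)))⁻¹ • (1 : Matrix U U ℂ) := by
  obtain ⟨x⟩ := ‹Nonempty X›
  ext t t'
  have h := sum_mul_signMat (a := a) (b := b) (X := X) (fun y => signMat X a b U (x, y) t) t'
  rw [Matrix.mul_apply]
  refine h.trans ?_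
  rw [Matrix.smul_apply, Matrix.one_apply]
  split_ifs with ht
  · subst ht
    rw [signMat_apply_left hab hU, signMat_apply_right hab hU, one_div, inv_inv, smul_eq_mul]
    ring
  · have hne : ∀ y, (y₀, y) ∈ t'.1 → (y₀, y) ∉ t.1 := fun y h1 h2 =>
      ht (Subtype.ext (hT.eq_of_mem (hU t.2).1 (hU t'.2).1 h2 h1))
    rw [signMat_apply_eq_zero hab hU _ (hne _ ((mem_iff_of_nbhd_eq hab (hU t'.2)).2 (Or.inl rfl))),
      signMat_apply_eq_zero hab hU _ (hne _ ((mem_iff_of_nbhd_eq hab (hU t'.2)).2 (Or.inr rfl)))]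
    simp

/-- The columns are constant along `X`, so they are eigenvectors of `σ_s̃` with the valency of `s`
as eigenvalue. -/
theorem adjMat_tildeRel_mul_signMat (hS : IsScheme S) {s : Set (X × X)} (hs : s ∈ S) (x₀ : X)
    {U : Set (Set (Y × Y))} [Fintype U] [DecidableEq U] :
    adjMat (tildeRel Y s) * signMat X a b U =
      signMat X a b U * (((nbhd x₀ s).ncard : ℂ) • (1 : Matrix U U ℂ)) := by
  classical
  ext ⟨x, y⟩ t
  have hk : ((nbhd x₀ s).ncard : ℂ) = ∑ x', if (x, x') ∈ s then 1 else 0 := by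
    rw [hS.ncard_nbhd_eq hs x₀ x, Set.ncard_eq_toFinset_card', Finset.sum_boole]
    congr 2
    ext x'
    simp [mem_nbhd]
  rw [Matrix.mul_smul, Matrix.mul_one, Matrix.smul_apply, smul_eq_mul, hk, Matrix.mul_apply,
    Fintype.sum_prod_type, Finset.sum_mul]
  refine Finset.sum_congr rfl fun x' _ => ?_
  rw [Finset.sum_eq_single y]
  · simp [adjMat_apply, tildeRel, signMat_apply]
  · intro y' _ hy
    simp [adjMat_apply, tildeRel, hy.symm]
  · simp

/-- The image of `w_t` is odd on each `y₀r` with `r ∈ U`, by `block_iff`, and vanishes at all other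
points: thin neighbours of `y₀` see `a t` and `b t` alike, and the remaining blocks are full by
`hclosed`. -/
theorem adjMat_barRel_mul_signMat (hT : IsQuasiThin T)
    (hab : ∀ t ∈ relsOfValency T 2, nbhd y₀ t = {a t, b t}) {U : Set (Set (Y × Y))} [Fintype U]
    (hU : U ⊆ relsOfValency T 2)
    (hclosed : ∀ t ∈ relsOfValency T 2, ∀ t' ∈ U, ¬IsFullBlock T y₀ t t' → t ∈ U)
    {u : Set (Y × Y)} (hu : u ∈ T) :
    ∃ K : Matrix U U ℂ, adjMat (barRel X u) * signMat X a b U = signMat X a b U * K := by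
  classical
  let d : Y → U → ℂ := fun y t =>
    (if (y, a t) ∈ u then 1 else 0) - (if (y, b t) ∈ u then 1 else 0)
  -- The coefficient of `w_t` is read off at the point `a t`, where `w_t` is 1; the factor `|X|`
  -- comes from summing over the `X`-coordinate.
  refine ⟨Matrix.of fun t t' => Fintype.card X * d (a t) t', ?_⟩
  ext ⟨x, y⟩ t
  have hL : (adjMat (barRel X u) * signMat X a b U) (x, y) t = Fintype.card X * d y t :=
    sum_mul_signMat (fun y' => if (y, y') ∈ u then 1 else 0) t
  rw [hL, Matrix.mul_apply]
  have ht := hU t.2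
  have ha := (mem_iff_of_nbhd_eq hab ht).2 (Or.inl rfl)
  have hb := (mem_iff_of_nbhd_eq hab ht).2 (Or.inr rfl)
  by_cases hy : ∃ r : U, (y₀, y) ∈ r.1
  · obtain ⟨r, hr⟩ := hy
    rw [Finset.sum_eq_single r]
    · obtain ⟨h1, h2⟩ := hT.1.block_iff hab (hU r.2) ht hu
      rcases (mem_iff_of_nbhd_eq hab (hU r.2)).1 hr with rfl | rfl
      · rw [signMat_apply_left hab hU, one_mul]
        rfl
      · rw [signMat_apply_right hab hU]
        simp only [d, Matrix.of_apply, h1, h2]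
        ring
    · intro r' _ hne
      rw [signMat_apply_eq_zero hab hU, zero_mul]
      exact fun h => hne (Subtype.ext (hT.1.eq_of_mem (hU r'.2).1 (hU r.2).1 h hr))
    · simp
  · push Not at hy
    rw [Finset.sum_eq_zero fun r _ => by rw [signMat_apply_eq_zero hab hU _ (hy r), zero_mul]]
    suffices h : (y, a t) ∈ u ↔ (y, b t) ∈ u by simp [d, h]
    obtain ⟨s, hs, hys⟩ := hT.1.exists_mem y₀ y
    have hs12 := hs
    rw [hT.2] at hs12
    rcases hs12 with hs1 | hs2
    -- Since `y` is the only `s`-neighbour of `y₀`, moving a path through `y` from one point of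
    -- `y₀t` to the other keeps it through `y`.
    · constructor <;> intro h
      · obtain ⟨w, hw, hw'⟩ := hT.1.exists_between hs hu ht.1 ha hb hys h
        rwa [nbhd_subsingleton hs1 hys hw]
      · obtain ⟨w, hw, hw'⟩ := hT.1.exists_between hs hu ht.1 hb ha hys h
        rwa [nbhd_subsingleton hs1 hys hw]
    · obtain ⟨v, hv, hf⟩ : IsFullBlock T y₀ s t :=
        not_not.1 fun hn => hy ⟨s, hclosed s hs2 t t.2 hn⟩ hys
      constructor <;> intro h
      · rw [hT.1.eq_of_mem hu hv h (hf _ _ hys ha)]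
        exact hf _ _ hys hb
      · rw [hT.1.eq_of_mem hu hv h (hf _ _ hys hb)]
        exact hf _ _ hys ha

theorem gMat_mul_gMat [Nonempty X] (hT : IsScheme T)
    (hab : ∀ t ∈ relsOfValency T 2, nbhd y₀ t = {a t, b t}) {t t' t'' : Set (Y × Y)}
    (ht : t ∈ relsOfValency T 2) (ht' : t' ∈ relsOfValency T 2) (ht'' : t'' ∈ relsOfValency T 2) :
    gMat X a b t t' * gMat X a b t' t'' = gMat X a b t t'' := by
  classical
  let U := relsOfValency T 2
  have : Fintype U := Fintype.ofFinite U
  have h := fun p q : U => gMat_eq_conjLin (X := X) a b p q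
  have h1 := h ⟨t, ht⟩ ⟨t', ht'⟩
  have h2 := h ⟨t', ht'⟩ ⟨t'', ht''⟩
  have h3 := h ⟨t, ht⟩ ⟨t'', ht''⟩
  dsimp only at h1 h2 h3
  rw [h1, h2, h3, ← conjLin_mul (by simp) (signMat_transpose_mul hT hab subset_rfl),
    Matrix.single_mul_single_same, one_mul]

variable [DecidableEq X]

theorem diagMat_tildeRel_mul_signMat (hT : IsScheme T)
    (hab : ∀ t ∈ relsOfValency T 2, nbhd y₀ t = {a t, b t}) {U : Set (Set (Y × Y))}
    (hU : U ⊆ relsOfValency T 2) (x₀ : X) (s : Set (X × X)) :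
    diagMat (nbhd (x₀, y₀) (tildeRel Y s)) * signMat X a b U = 0 := by
  ext ⟨x, y⟩ t
  rw [diagMat, Matrix.diagonal_mul]
  split_ifs with h
  · obtain rfl : y₀ = y := h.2
    rw [signMat_apply_eq_zero hab hU, mul_zero, Matrix.zero_apply]
    exact fun h => hT.ne_of_mem_relsOfValency_two (hU t.2) h rfl
  · rw [zero_mul, Matrix.zero_apply]

theorem diagMat_barRel_mul_signMat (hT : IsScheme T)
    (hab : ∀ t ∈ relsOfValency T 2, nbhd y₀ t = {a t, b t}) {U : Set (Set (Y × Y))} [Fintype U]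
    (hU : U ⊆ relsOfValency T 2) (x₀ : X) {s : Set (Y × Y)} (hs : s ∈ T) :
    ∃ K : Matrix U U ℂ,
      diagMat (nbhd (x₀, y₀) (barRel X s)) * signMat X a b U = signMat X a b U * K := by
  classical
  refine ⟨Matrix.diagonal fun t => if t.1 = s then 1 else 0, ?_⟩
  ext ⟨x, y⟩ t
  rw [diagMat, Matrix.diagonal_mul, Matrix.mul_diagonal, mul_comm]
  by_cases hy : (y₀, y) ∈ t.1
  · congr 1
    have : (x, y) ∈ nbhd (x₀, y₀) (barRel X s) ↔ t.1 = s :=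
      ⟨fun h => hT.eq_of_mem (hU t.2).1 hs hy h, fun h => h ▸ hy⟩
    simp only [this]
  · rw [signMat_apply_eq_zero hab hU _ hy, zero_mul, zero_mul]

theorem exists_mul_signMat_eq (hS : IsScheme S) (hT : IsQuasiThin T)
    (hab : ∀ t ∈ relsOfValency T 2, nbhd y₀ t = {a t, b t}) {U : Set (Set (Y × Y))} [Fintype U]
    (hU : U ⊆ relsOfValency T 2)
    (hclosed : ∀ t ∈ relsOfValency T 2, ∀ t' ∈ U, ¬IsFullBlock T y₀ t t' → t ∈ U) (x₀ : X)
    {g : Matrix (X × Y) (X × Y) ℂ} (hg : g ∈ terwilligerAlgebra (wreathProd S T) (x₀, y₀)) :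
    ∃ K : Matrix U U ℂ, g * signMat X a b U = signMat X a b U * K := by
  classical
  refine exists_mul_eq_of_mem_adjoin ?_ hg
  rintro _ (⟨_, ⟨s, hs, rfl⟩ | ⟨t, ht, rfl⟩, rfl⟩ | ⟨_, ⟨s, hs, rfl⟩ | ⟨t, ht, rfl⟩, rfl⟩)
  · exact ⟨_, adjMat_tildeRel_mul_signMat hS hs x₀⟩
  · exact adjMat_barRel_mul_signMat hT hab hU hclosed ht.1
  · exact ⟨0, by rw [diagMat_tildeRel_mul_signMat hT.1 hab hU, Matrix.mul_zero]⟩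
  · exact diagMat_barRel_mul_signMat hT.1 hab hU x₀ ht.1

/-- The relations `u` of `(a t, a t')` and `v` of `(a t, b t')` differ, since otherwise `block_iff`
would make the block full. They cut it into its diagonal and antidiagonal, so `G` is a multiple of
`E (σ_ū - σ_v̄) E'`. -/
theorem gMat_mem_of_not_isFullBlock (hS : IsScheme S) (hT : IsScheme T)
    (hab : ∀ t ∈ relsOfValency T 2, nbhd y₀ t = {a t, b t}) (x₀ : X) {t t' : Set (Y × Y)}
    (ht : t ∈ relsOfValency T 2) (ht' : t' ∈ relsOfValency T 2) (hn : ¬IsFullBlock T y₀ t t') :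
    gMat X a b t t' ∈ terwilligerAlgebra (wreathProd S T) (x₀, y₀) := by
  classical
  have hone : ∀ t ∈ relsOfValency T 2, t ≠ idRel Set.univ := fun t ht =>
    have h := (mem_iff_of_nbhd_eq hab ht).2 (Or.inl rfl)
    ne_idRel_of_mem h (hT.ne_of_mem_relsOfValency_two ht h)
  obtain ⟨u, hu, h11⟩ := hT.exists_mem (a t) (a t')
  obtain ⟨v, hv, h12⟩ := hT.exists_mem (a t) (b t')
  obtain ⟨iu, iu'⟩ := hT.block_iff hab ht ht' hu
  obtain ⟨iv, iv'⟩ := hT.block_iff hab ht ht' hv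
  have huv : u ≠ v := by
    rintro rfl
    refine hn ⟨u, hu, fun z z' hz hz' => ?_⟩
    rcases (mem_iff_of_nbhd_eq hab ht).1 hz with rfl | rfl <;>
      rcases (mem_iff_of_nbhd_eq hab ht').1 hz' with rfl | rfl
    exacts [h11, h12, iu'.1 h12, iu.1 h11]
  have h12' : (a t, b t') ∉ u := fun h => huv (hT.eq_of_mem hu hv h h12)
  have h11' : (a t, a t') ∉ v := fun h => huv (hT.eq_of_mem hu hv h11 h)
  have hne := left_ne_right_of_nbhd_eq hab ht
  have hne' := left_ne_right_of_nbhd_eq hab ht'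
  let E := diagMat (nbhd (x₀, y₀) (barRel X t))
  let E' := diagMat (nbhd (x₀, y₀) (barRel X t'))
  have key : gMat X a b t t' = (1 / (2 * (Fintype.card X : ℂ))) •
      (E * adjMat (barRel X u) * E' - E * adjMat (barRel X v) * E') := by
    have hu22 := iu.1 h11
    have hv21 := iv'.1 h12
    have hu21 : (b t, a t') ∉ u := fun h => h12' (iu'.2 h)
    have hv22 : (b t, b t') ∉ v := fun h => h11' (iv.2 h)
    ext ⟨x, y⟩ ⟨x', y'⟩
    have hb : ∀ p q : Y, blockOnes {p} {q} y y' =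
        (if y = p then 1 else 0) * (if y' = q then (1 : ℂ) else 0) := fun p q => by
      simp [blockOnes, diagMat, Matrix.diagonal_mul, Matrix.mul_diagonal, allOnes]
    have hE : ∀ w : Set (Y × Y), (E * adjMat (barRel X w) * E') (x, y) (x', y') =
        (if y = a t ∨ y = b t then 1 else 0) * (if (y, y') ∈ w then 1 else 0) *
          (if y' = a t' ∨ y' = b t' then 1 else 0) := fun w => by
      have m1 : (x, y) ∈ nbhd (x₀, y₀) (barRel X t) ↔ _ := mem_iff_of_nbhd_eq hab ht
      have m2 : (x', y') ∈ nbhd (x₀, y₀) (barRel X t') ↔ _ := mem_iff_of_nbhd_eq hab ht'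
      have m3 : ((x, y), (x', y')) ∈ barRel X w ↔ (y, y') ∈ w := Iff.rfl
      simp only [E, E', diagMat, Matrix.diagonal_mul, Matrix.mul_diagonal, adjMat_apply, m1, m2, m3]
    rw [Matrix.smul_apply, Matrix.sub_apply, hE, hE, gMat, Matrix.smul_apply,
      Matrix.kroneckerMap_apply, Matrix.sub_apply, Matrix.sub_apply, Matrix.add_apply, hb, hb, hb,
      hb]
    congr 1
    by_cases hy : y = a t ∨ y = b t
    · by_cases hy' : y' = a t' ∨ y' = b t'
      · rcases hy with rfl | rfl <;> rcases hy' with rfl | rfl <;>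
          simp [allOnes, *, hne.symm, hne'.symm]
      · rw [not_or] at hy'
        simp [hy'.1, hy'.2]
    · rw [not_or] at hy
      simp [hy.1, hy.2]
  rw [key]
  have hE := diagMat_barRel_mem (S := S) (X := X) ht.1 (hone t ht) (x₀, y₀)
  have hE' := diagMat_barRel_mem (S := S) (X := X) ht'.1 (hone t' ht') (x₀, y₀)
  exact Subalgebra.smul_mem _ (sub_mem (mul_mem (mul_mem hE (adjMat_barRel_mem hS hu _)) hE')
    (mul_mem (mul_mem hE (adjMat_barRel_mem hS hv _)) hE')) _

theorem isIdealIsoMat_gSpan (hS : IsScheme S) (hT : IsQuasiThin T)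
    (hab : ∀ t ∈ relsOfValency T 2, nbhd y₀ t = {a t, b t}) {U : Set (Set (Y × Y))}
    (hU : U ⊆ relsOfValency T 2)
    (hclosed : ∀ t ∈ relsOfValency T 2, ∀ t' ∈ U, ¬IsFullBlock T y₀ t t' → t ∈ U) (x₀ : X)
    (hmem : ∀ t ∈ U, ∀ t' ∈ U,
      gMat X a b t t' ∈ terwilligerAlgebra (wreathProd S T) (x₀, y₀)) :
    IsIdealIsoMat (terwilligerAlgebra (wreathProd S T) (x₀, y₀)) (gSpan X a b U) U := by
  classical
  have : Fintype U := Fintype.ofFinite U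
  have : Nonempty X := ⟨x₀⟩
  rw [gSpan_eq_range]
  have hl := fun g hg => exists_mul_signMat_eq hS hT hab hU hclosed x₀ (g := g) hg
  refine isIdealIsoMat_of_conjLin (by simp) (signMat_transpose_mul hT.1 hab hU) ?_ hl ?_
  · intro t t'
    rw [← gMat_eq_conjLin]
    exact hmem t t.2 t' t'.2
  · intro g hg
    obtain ⟨K, hK⟩ := hl _ (transpose_mem_terwilligerAlgebra hS hT.1 _ hg)
    refine ⟨K.transpose, Matrix.transpose_injective ?_⟩
    rw [Matrix.transpose_mul, Matrix.transpose_transpose, hK, Matrix.transpose_mul,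
      Matrix.transpose_transpose, Matrix.transpose_transpose]

theorem gMat_mem_of_orthogonals (hS : IsScheme S) (hT : IsQuasiThin T)
    (hab : ∀ t ∈ relsOfValency T 2, nbhd y₀ t = {a t, b t}) (x₀ : X)
    (ho : orthogonals T ⊆ relsOfValency T 2 ∨ 2 ≤ (orthogonals T).ncard) {t t' : Set (Y × Y)}
    (ht : t ∈ relsOfValency T 2) (ht' : t' ∈ relsOfValency T 2) :
    gMat X a b t t' ∈ terwilligerAlgebra (wreathProd S T) (x₀, y₀) := by
  by_cases hf : IsFullBlock T y₀ t t'
  swap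
  · exact gMat_mem_of_not_isFullBlock hS hT.1 hab x₀ ht ht' hf
  obtain ⟨w, hw, hwt, hwt'⟩ := hf.exists_orthogonal hT ht ht'
  rcases ho with ho | ho
  · have h2 := (ho ⟨hw.1, t, ht, hwt⟩).2 y₀
    rw [hw.2] at h2
    omega
  · have : Nonempty X := ⟨x₀⟩
    -- An `r` with `r^⊥ ≠ w` has no full block with `t` or `t'`, so `G` factors through `r`.
    obtain ⟨w', ⟨hw', r, hr, hwr⟩, hne⟩ := Set.exists_ne_of_one_lt_ncard ho w
    have hpair : ∀ v, ({idRel Set.univ, w} : Set (Set (Y × Y))) = {idRel Set.univ, v} →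
        {idRel Set.univ, w'} = ({idRel Set.univ, v} : Set (Set (Y × Y))) → False := by
      intro v h1 h2
      have h := h1.trans h2.symm
      have m1 : w ∈ ({idRel Set.univ, w'} : Set (Set (Y × Y))) := h ▸ Or.inr rfl
      have m2 : w' ∈ ({idRel Set.univ, w} : Set (Set (Y × Y))) := h ▸ Or.inr rfl
      rcases m1 with m1 | m1
      · rcases m2 with m2 | m2
        · exact hne (m2.trans m1.symm)
        · exact hne m2
      · exact hne m1.symm
    rw [← gMat_mul_gMat hT.1 hab ht hr ht']
    refine mul_mem (gMat_mem_of_not_isFullBlock hS hT.1 hab x₀ ht hr ?_)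
      (gMat_mem_of_not_isFullBlock hS hT.1 hab x₀ hr ht' ?_)
    · intro hf'
      obtain ⟨v, -, h1, h2⟩ := hf'.exists_orthogonal hT ht hr
      exact hpair v (hwt.symm.trans h1) (hwr.symm.trans h2)
    · intro hf'
      obtain ⟨v, -, h1, h2⟩ := hf'.exists_orthogonal hT hr ht'
      exact hpair v (hwt'.symm.trans h2) (hwr.symm.trans h1)

end SignVectors
-- The two cases of the theorem
theorem lemma3p5 {X Y : Type*} [Fintype X] [DecidableEq X] [Fintype Y] [DecidableEq Y]
    (S : Set (Set (X × X))) (hS : IsScheme S) (x₀ : X)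
    (T : Set (Set (Y × Y))) (hT : IsQuasiThin T) (hT' : (orthogonals T).Nonempty) (y₀ : Y)
    (a b : Set (Y × Y) → Y) (hab : ∀ t ∈ relsOfValency T 2, nbhd y₀ t = {a t, b t}) :
    (((orthogonals T).ncard = 1 ∧ orthogonals T ⊆ relsOfValency T 2) ∨
        2 ≤ (orthogonals T).ncard →
      IsIdealIsoMat (terwilligerAlgebra (wreathProd S T) (x₀, y₀))
        (gSpan X a b (relsOfValency T 2)) (relsOfValency T 2)) ∧
    ((orthogonals T).ncard = 1 ∧ orthogonals T ⊆ relsOfValency T 1 →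
      ∀ i ∈ fiberClasses T, y₀ ∉ ⋃₀ i →
        IsIdealIsoMat (terwilligerAlgebra (wreathProd S T) (x₀, y₀))
          (gSpan X a b (relsOfClass T y₀ i)) (relsOfClass T y₀ i)) := by
  refine ⟨fun ho => ?_, ?_⟩
  · exact isIdealIsoMat_gSpan hS hT hab subset_rfl (fun t ht _ _ _ => ht) x₀ fun t ht t' ht' =>
      gMat_mem_of_orthogonals hS hT hab x₀ (ho.imp_left And.right) ht ht'
  · rintro ⟨hcard, ho1⟩ i hi -
    obtain ⟨h, ho⟩ := Set.ncard_eq_one.1 hcard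
    have h1 : h ∈ relsOfValency T 1 := ho1 (ho ▸ rfl)
    exact isIdealIsoMat_gSpan hS hT hab (fun t ht => ht.1)
      (fun t ht t' ht' hn => hT.mem_relsOfClass_of_not_isFullBlock ho h1 hi ht ht' hn) x₀
      fun t ht t' ht' => gMat_mem_of_not_isFullBlock hS hT.1 hab x₀ ht.1 ht'.1
        (hT.not_isFullBlock_of_mem_relsOfClass ho h1 hi ht ht')
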